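/- **Theorem 4 (S-bound for tori).** Let $k$ be a field, $\ell$ a prime number different from $\operatorname{char}(k)$, and let $\chi:\Gamma_k\to\mathbf Z_\ell^*$ be the $\ell^\infty$-cyclotomic character of the absolute Galois group of $k$ (so $g\zeta=\zeta^{\chi(g)}$ for every root of unity $\zeta$ of $\ell$-power order). Define $t\ge 1$ and $m\in\{1,2,\dots,\infty\}$ as follows, with the convention $\ell^\infty=0$. If $\ell\ne 2$, then $\operatorname{Im}\chi=C_t\times(1+\ell^m\mathbf Z_\ell)$ with $t\mid \ell-1$, $C_t$ cyclic of order $t$, and $m\ge 1$. If $\ell=2$, then, with $m\ge 2$, either $\operatorname{Im}\chi=1+2^m\mathbf Z_2$ and $t=1$; or $\operatorname{Im}\chi$ is the closed subgroup generated by $-1+2^m$ and $t=2$; or $\operatorname{Im}\chi=\{1,-1\}\times(1+2^m\mathbf Z_2)$ and $t=2$. Let $T$ be a torus over $k$ (an algebraic group over $k$ that becomes isomorphic to $\mathbf G_m^{n}$ over an algebraic closure of $k$, where $n=\dim T$), and let $A$ be a finite subgroup of $T(k)$. Let $v_\ell(A)$ be the exponent of $\ell$ in the order of $A$, let $\varphi$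 be Euler's function, and let $[\,\cdot\,]$ denote the integral part. Then $$v_\ell(A)\;\le\; m\left[\frac{\dim T}{\varphi(t)}\right],$$ where $\infty\cdot 0=0$. -/

import Mathlib

open scoped TensorProduct

/-! ### Tori

An affine algebraic group `T` over a field `k` is given by its coordinate ring `H = k[T]`, a
commutative Hopf algebra over `k` (so `T = Spec H`). For a `k`-algebra `R`, the group `T(R)` is the
set of `k`-algebra homomorphisms `H → R` with the convolution product, which is Mathlib's group
`WithConv (H →ₐ[k] R)`. The coordinate ring of `𝔾ₘⁿ` over a field `K` is the group algebra
`K[ℤⁿ]` (Laurent polynomials in `n` variables), whose Hopf algebra structure is the one in which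
each Laurent monomial is group-like. -/

/-- `T = Spec H` is an `n`-dimensional torus over `k`: over an algebraic closure of `k` it becomes
isomorphic, as an algebraic group, to `𝔾ₘⁿ`. -/
def IsTorusOfDim (k : Type*) [Field k] (H : Type*) [CommRing H] [HopfAlgebra k H] (n : ℕ) : Prop :=
  Nonempty (AlgebraicClosure k ⊗[k] H ≃ₐc[AlgebraicClosure k]
    AddMonoidAlgebra (AlgebraicClosure k) (Fin n → ℤ))

/-- The group `T(k)` of `k`-rational points of `T = Spec H`. -/
abbrev RationalPoints (k : Type*) [Field k] (H : Type*) [CommRing H] [HopfAlgebra k H] : Type _ :=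
  WithConv (H →ₐ[k] k)

/-! ### The cyclotomic invariants -/

section Invariants

variable (ℓ : ℕ) [Fact ℓ.Prime]

/-- `ℓ ^ d` in `ℤ_ℓ`, with the convention `ℓ ^ ∞ = 0`. -/
noncomputable def ellPow : ℕ∞ → ℤ_[ℓ]
  | ⊤ => 0
  | (d : ℕ) => (ℓ : ℤ_[ℓ]) ^ d

/-- The subgroup `1 + ℓ ^ d ℤ_ℓ` of `ℤ_ℓˣ` (all of `ℤ_ℓˣ` for `d = 0`, trivial for `d = ∞`). -/
def principalUnits (d : ℕ∞) : Subgroup ℤ_[ℓ]ˣ where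
  carrier := {x | ellPow ℓ d ∣ (x : ℤ_[ℓ]) - 1}
  one_mem' := by simp
  mul_mem' {x y} hx hy := by
    have h : ((x * y : ℤ_[ℓ]ˣ) : ℤ_[ℓ]) - 1 = x * ((y : ℤ_[ℓ]) - 1) + ((x : ℤ_[ℓ]) - 1) := by
      push_cast; ring
    simp only [Set.mem_ofPred_eq] at hx hy ⊢
    rw [h]
    exact dvd_add (hy.mul_left _) hx
  inv_mem' {x} hx := by
    have h : ((x⁻¹ : ℤ_[ℓ]ˣ) : ℤ_[ℓ]) - 1 = -(x⁻¹ : ℤ_[ℓ]ˣ) * ((x : ℤ_[ℓ]) - 1) := by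
      rw [mul_sub, neg_mul, Units.inv_mul]; ring
    simp only [Set.mem_ofPred_eq] at hx ⊢
    rw [h]
    exact hx.mul_left _

/-- The torsion factor `C` in the decomposition `ℤ_ℓˣ = C × (1 + q ℤ_ℓ)`, where
`q = ℓ`, `C = μ_{ℓ-1}` if `ℓ ≠ 2`, and `q = 4`, `C = {1, -1}` if `ℓ = 2`. -/
noncomputable def torsionUnits : Subgroup ℤ_[ℓ]ˣ :=
  rootsOfUnity (if ℓ = 2 then 2 else ℓ - 1) ℤ_[ℓ]

variable {ℓ}

/-- The invariant `t` of a subgroup `I` of `ℤ_ℓˣ`: the order of the projection of `I` to the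
factor `C` of `ℤ_ℓˣ = C × (1 + q ℤ_ℓ)`, that is, of the image of `I` in
`(ℤ_ℓ / q)ˣ ≅ C` (`q = ℓ` if `ℓ ≠ 2`, and `q = 4` if `ℓ = 2`). -/
noncomputable def unitInvT (I : Subgroup ℤ_[ℓ]ˣ) : ℕ :=
  Nat.card (I.map (Units.map
    (PadicInt.toZModPow (p := ℓ) (if ℓ = 2 then 2 else 1)).toMonoidHom))

/-- The invariant `m` of a subgroup `I` of `ℤ_ℓˣ`: the largest `d ≤ ∞` such that
`I ⊆ C × (1 + ℓ ^ d ℤ_ℓ)`, that is, such that `1 + ℓ ^ d ℤ_ℓ` contains the projection of `I` to the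
factor `1 + q ℤ_ℓ` of `ℤ_ℓˣ = C × (1 + q ℤ_ℓ)`. -/
noncomputable def unitInvM (I : Subgroup ℤ_[ℓ]ˣ) : ℕ∞ :=
  sSup {d : ℕ∞ | I ≤ torsionUnits ℓ ⊔ principalUnits ℓ d}

/-- The case-by-case description of the pair `(t, m)` attached to a closed subgroup `I` of `ℤ_ℓˣ`:

* `ℓ ≠ 2`: `I = C_t × (1 + ℓ ^ m ℤ_ℓ)` with `t ∣ ℓ - 1`, `C_t` cyclic of order `t`, `1 ≤ m ≤ ∞`;
* `ℓ = 2`, with `2 ≤ m ≤ ∞`: either `t = 1` and `I = 1 + 2 ^ m ℤ_2`, or `t = 2` and `I` is the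
  closed subgroup generated by `-1 + 2 ^ m`, or `t = 2` and `I = {1, -1} × (1 + 2 ^ m ℤ_2)`. -/
def HasInvariants (I : Subgroup ℤ_[ℓ]ˣ) (t : ℕ) (m : ℕ∞) : Prop :=
  (ℓ ≠ 2 ∧ 1 ≤ m ∧ t ∣ ℓ - 1 ∧ ∃ C : Subgroup ℤ_[ℓ]ˣ,
      IsCyclic C ∧ Nat.card C = t ∧ I = C ⊔ principalUnits ℓ m) ∨
  (ℓ = 2 ∧ 2 ≤ m ∧
    ((t = 1 ∧ I = principalUnits ℓ m) ∨
     (t = 2 ∧ ∃ x : ℤ_[ℓ]ˣ, (x : ℤ_[ℓ]) = -1 + ellPow ℓ m ∧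
        I = (Subgroup.zpowers x).topologicalClosure) ∨
     (t = 2 ∧ I = Subgroup.zpowers (-1) ⊔ principalUnits ℓ m)))

end Invariants

section Field

variable (k : Type*) [Field k] (ℓ : ℕ) [Fact ℓ.Prime]

/-- The image `Im χ` in `ℤ_ℓˣ` of the `ℓ^∞`-cyclotomic character `χ : Γ_k → ℤ_ℓˣ` of the absolute
Galois group of `k`, defined by `g ζ = ζ ^ χ(g)` for `ζ` of `ℓ`-power order. -/
noncomputable def cyclotomicImage : Subgroup ℤ_[ℓ]ˣ :=
  ((cyclotomicCharacter (AlgebraicClosure k) ℓ).comp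
    (MulSemiringAction.toRingAut Gal(AlgebraicClosure k/k) (AlgebraicClosure k))).range

/-- The cyclotomic invariant `t` of `k` at `ℓ`. -/
noncomputable def cyclotomicT : ℕ := unitInvT (cyclotomicImage k ℓ)

/-- The cyclotomic invariant `m` of `k` at `ℓ`, possibly infinite. -/
noncomputable def cyclotomicM : ℕ∞ := unitInvM (cyclotomicImage k ℓ)

end Field

section Agree
variable {ℓ : ℕ} [Fact ℓ.Prime]

theorem mem_principalUnits {d : ℕ∞} {x : ℤ_[ℓ]ˣ} :
    x ∈ principalUnits ℓ d ↔ ellPow ℓ d ∣ (x : ℤ_[ℓ]) - 1 := Iff.rfl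

theorem ellPow_coe (d : ℕ) : ellPow ℓ (d : ℕ∞) = (ℓ : ℤ_[ℓ]) ^ d := rfl

theorem ellPow_top : ellPow ℓ ⊤ = 0 := rfl

theorem principalUnits_anti {d e : ℕ∞} (h : d ≤ e) : principalUnits ℓ e ≤ principalUnits ℓ d := by
  intro x hx
  rw [mem_principalUnits] at *
  refine dvd_trans ?_ hx
  induction e with
  | top => simp [ellPow_top]
  | coe e =>
    lift d to ℕ using ne_top_of_le_ne_top (ENat.natCast_ne_top e) h
    rw [ellPow_coe, ellPow_coe]
    exact pow_dvd_pow _ (by exact_mod_cast h)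

theorem mem_principalUnits_coe {d : ℕ} {x : ℤ_[ℓ]ˣ} :
    x ∈ principalUnits ℓ d ↔ Units.map (PadicInt.toZModPow (p := ℓ) d).toMonoidHom x = 1 := by
  rw [mem_principalUnits, ellPow_coe, ← Ideal.mem_span_singleton, ← PadicInt.ker_toZModPow,
    RingHom.mem_ker, Units.ext_iff]
  simp [sub_eq_zero]

theorem isOpen_principalUnits (d : ℕ) : IsOpen (principalUnits ℓ d : Set ℤ_[ℓ]ˣ) := by
  have : (principalUnits ℓ d : Set ℤ_[ℓ]ˣ) =
      {x : ℤ_[ℓ]ˣ | ‖(x : ℤ_[ℓ]) - 1‖ < (ℓ : ℝ) ^ (-(d : ℤ) + 1)} := by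
    ext x
    rw [SetLike.mem_coe, mem_principalUnits, ellPow_coe, ← Ideal.mem_span_singleton,
      ← PadicInt.norm_le_pow_iff_mem_span_pow, PadicInt.norm_le_pow_iff_norm_lt_pow_add_one]
    rfl
  rw [this]
  exact isOpen_lt (by fun_prop) continuous_const

theorem torsion_eq_one {x : ℤ_[ℓ]ˣ} (hx : x ∈ torsionUnits ℓ)
    (h : x ∈ principalUnits ℓ (if ℓ = 2 then 2 else 1 : ℕ)) : x = 1 := by
  set e := if ℓ = 2 then 2 else 1 with he
  set w := if ℓ = 2 then 2 else ℓ - 1 with hw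
  have hp : ℓ.Prime := Fact.out
  have hx' : (x : ℤ_[ℓ]) ^ w = 1 := by
    have := (mem_rootsOfUnity _ _).1 hx
    rw [← Units.val_pow_eq_pow_val, this, Units.val_one]
  have h' : PadicInt.toZModPow (p := ℓ) e x = 1 := by
    simpa using congrArg Units.val (mem_principalUnits_coe.1 h)
  have hs : (∑ i ∈ Finset.range w, (x : ℤ_[ℓ]) ^ i) ≠ 0 := by
    intro h0
    have := congrArg (PadicInt.toZModPow (p := ℓ) e) h0
    simp only [map_sum, map_pow, h', one_pow, Finset.sum_const, Finset.card_range, map_zero,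
      nsmul_eq_mul, mul_one] at this
    rw [ZMod.natCast_eq_zero_iff] at this
    by_cases h2 : ℓ = 2
    · simp only [he, hw, h2] at this; norm_num at this
    · simp only [he, hw, h2, if_false, pow_one] at this
      have := Nat.le_of_dvd (by have := hp.two_le; omega) this
      have := hp.two_le
      omega
  have := geom_sum_mul (x : ℤ_[ℓ]) w
  rw [hx', sub_self, mul_eq_zero, or_iff_right hs, sub_eq_zero] at this
  exact Units.ext this

theorem unitInvM_eq {I : Subgroup ℤ_[ℓ]ˣ} {m : ℕ∞} (hm : ((if ℓ = 2 then 2 else 1 : ℕ) : ℕ∞) ≤ m)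
    (h : I ≤ torsionUnits ℓ ⊔ principalUnits ℓ m)
    (h' : ∀ n : ℕ, m = n → ∃ c ∈ torsionUnits ℓ, ∃ u ∈ principalUnits ℓ n,
      u ∉ principalUnits ℓ (n + 1 : ℕ) ∧ c * u ∈ I) : unitInvM I = m := by
  refine le_antisymm (sSup_le fun d hd => ?_) (le_sSup h)
  by_contra! hlt
  lift m to ℕ using hlt.ne_top
  obtain ⟨c, hc, u, hu, hu', hI⟩ := h' m rfl
  obtain ⟨c', hc', u', hu2, he⟩ := Subgroup.mem_sup.1 (hd hI)
  have hd' : ((m + 1 : ℕ) : ℕ∞) ≤ d := by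
    push_cast; exact Order.add_one_le_of_lt hlt
  have h1 : c'⁻¹ * c = u' * u⁻¹ := by
    rw [eq_mul_inv_iff_mul_eq, mul_assoc, ← he]; simp
  have h2 : c'⁻¹ * c = 1 := by
    refine torsion_eq_one (mul_mem (inv_mem hc') hc) ?_
    rw [h1]
    exact mul_mem (principalUnits_anti (hm.trans hlt.le) hu2)
      (inv_mem (principalUnits_anti hm hu))
  rw [h2, eq_comm, mul_inv_eq_one] at h1
  exact hu' (h1 ▸ principalUnits_anti hd' hu2)

theorem exists_unit (a : ℤ_[ℓ]) (ha : a = 1 ∨ a = -1) {n : ℕ} (hn : 1 ≤ n) :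
    ∃ u : ℤ_[ℓ]ˣ, (u : ℤ_[ℓ]) = 1 + a * ℓ ^ n ∧
      u ∈ principalUnits ℓ n ∧ u ∉ principalUnits ℓ (n + 1 : ℕ) := by
  have hp : ℓ.Prime := Fact.out
  have hmem : a * (ℓ : ℤ_[ℓ]) ^ n ∈ IsLocalRing.maximalIdeal ℤ_[ℓ] := by
    rw [PadicInt.maximalIdeal_eq_span_p, Ideal.mem_span_singleton]
    exact (dvd_pow_self _ (by omega)).mul_left _
  have hu : IsUnit (1 + a * (ℓ : ℤ_[ℓ]) ^ n) := by
    by_contra hnu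
    have : (1 : ℤ_[ℓ]) ∈ IsLocalRing.maximalIdeal ℤ_[ℓ] := by
      have := sub_mem ((IsLocalRing.mem_maximalIdeal _).2 hnu) hmem
      rwa [add_sub_cancel_right] at this
    exact (IsLocalRing.mem_maximalIdeal _).1 this isUnit_one
  have hau : IsUnit a := by rcases ha with rfl | rfl <;> simp
  refine ⟨hu.unit, rfl, ?_, ?_⟩
  · rw [mem_principalUnits, ellPow_coe]; simp
  · rw [mem_principalUnits, ellPow_coe]
    simp only [IsUnit.unit_spec, add_sub_cancel_left, hau.dvd_mul_left]
    intro hd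
    have h0 : (ℓ : ℤ_[ℓ]) ≠ 0 := by exact_mod_cast hp.ne_zero
    have := (pow_dvd_pow_iff h0 PadicInt.p_nonunit).1 hd
    omega

theorem map_principalUnits {n : ℕ} {m : ℕ∞} (h : (n : ℕ∞) ≤ m) :
    (principalUnits ℓ m).map (Units.map (PadicInt.toZModPow (p := ℓ) n).toMonoidHom) = ⊥ := by
  rw [Subgroup.map_eq_bot_iff]
  exact fun x hx => mem_principalUnits_coe.1 (principalUnits_anti h hx)

/-- `unitInvT` and `unitInvM` are the invariants of the case-by-case description. -/
theorem HasInvariants.eq {I : Subgroup ℤ_[ℓ]ˣ} {t : ℕ} {m : ℕ∞} (h : HasInvariants I t m) :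
    unitInvT I = t ∧ unitInvM I = m := by
  obtain ⟨h2, hm, ht, C, -, hCt, rfl⟩ | ⟨rfl, hm, h⟩ := h
  · have he : (if ℓ = 2 then 2 else 1) = 1 := if_neg h2
    have hm' : (((if ℓ = 2 then 2 else 1) : ℕ) : ℕ∞) ≤ m := by simpa [h2] using hm
    have hC : C ≤ torsionUnits ℓ := by
      intro x hx
      rw [torsionUnits, if_neg h2, mem_rootsOfUnity]
      obtain ⟨s, hs⟩ := ht
      have : x ^ t = 1 := by
        have := pow_card_eq_one' (G := C) (x := ⟨x, hx⟩)
        rw [hCt] at this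
        exact congrArg Subtype.val this
      rw [hs, pow_mul, this, one_pow]
    constructor
    · rw [unitInvT, Subgroup.map_sup, map_principalUnits hm', sup_bot_eq, ← hCt]
      refine (Nat.card_congr (Equiv.ofBijective
        (fun x : C => (⟨_, Subgroup.mem_map_of_mem _ x.2⟩ : C.map _)) ⟨?_, ?_⟩)).symm
      · intro x y hxy
        have hxy' := congrArg Subtype.val hxy
        have : (x : ℤ_[ℓ]ˣ) * (y : ℤ_[ℓ]ˣ)⁻¹ = 1 := by
          refine torsion_eq_one (mul_mem (hC x.2) (inv_mem (hC y.2))) ?_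
          rw [mem_principalUnits_coe, map_mul, map_inv, mul_inv_eq_one]
          exact hxy'
        exact Subtype.ext (mul_inv_eq_one.1 this)
      · rintro ⟨_, x, hx, rfl⟩
        exact ⟨⟨x, hx⟩, rfl⟩
    · refine unitInvM_eq hm' (sup_le_sup_right hC _) ?_
      rintro n rfl
      obtain ⟨u, -, hu, hu'⟩ := exists_unit (ℓ := ℓ) 1 (Or.inl rfl) (n := n) (by exact_mod_cast hm)
      exact ⟨1, one_mem _, u, hu, hu', by rw [one_mul]; exact Subgroup.mem_sup_right hu⟩
  · have hm' : (((if (2 : ℕ) = 2 then 2 else 1) : ℕ) : ℕ∞) ≤ m := by simpa using hm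
    have hneg : (-1 : ℤ_[2]ˣ) ∈ torsionUnits 2 := by
      simp [torsionUnits, mem_rootsOfUnity]
    have hn1 : ∀ n : ℕ, m = n → 1 ≤ n := by
      rintro n rfl
      have : 2 ≤ n := by exact_mod_cast hm
      omega
    have hcard : Nat.card (Subgroup.zpowers (Units.map
        (PadicInt.toZModPow (p := 2) (if (2 : ℕ) = 2 then 2 else 1)).toMonoidHom
          (-1 : ℤ_[2]ˣ))) = 2 := by
      rw [Nat.card_zpowers, orderOf_eq_prime_iff]
      refine ⟨by rw [← map_pow]; simp, ?_⟩
      intro h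
      have := mem_principalUnits_coe.2 h
      have := torsion_eq_one hneg this
      have := congrArg Units.val this
      have h3 : (2 : ℤ_[2]) = 0 := by
        have h4 : (-1 : ℤ_[2]) = 1 := by simpa using this
        linear_combination -h4
      norm_num at h3
    obtain ⟨rfl, rfl⟩ | ⟨rfl, x, hx, rfl⟩ | ⟨rfl, rfl⟩ := h
    · refine ⟨by rw [unitInvT, map_principalUnits hm']; simp, unitInvM_eq hm' le_sup_right ?_⟩
      rintro n rfl
      obtain ⟨u, -, hu, hu'⟩ := exists_unit (ℓ := 2) 1 (Or.inl rfl) (n := n) (hn1 n rfl)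
      exact ⟨1, one_mem _, u, hu, hu', by rwa [one_mul]⟩
    · have hxu : -x ∈ principalUnits 2 m := by
        rw [mem_principalUnits, Units.val_neg, hx]
        exact ⟨-1, by ring⟩
      have hxe : x = -1 * -x := by simp
      have hred : Units.map (PadicInt.toZModPow (p := 2)
          (if (2 : ℕ) = 2 then 2 else 1)).toMonoidHom x = Units.map (PadicInt.toZModPow (p := 2)
          (if (2 : ℕ) = 2 then 2 else 1)).toMonoidHom (-1) := by
        conv_lhs => rw [hxe, map_mul]
        rw [mem_principalUnits_coe.1 (principalUnits_anti hm' hxu), mul_one]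
      have hmem : x ∈ (Subgroup.zpowers x).topologicalClosure :=
        Subgroup.le_topologicalClosure _ (Subgroup.mem_zpowers x)
      constructor
      · refine Eq.trans ?_ hcard
        refine congrArg (fun S : Subgroup _ => Nat.card S) ?_
        refine le_antisymm ?_ ?_
        · rw [Subgroup.map_le_iff_le_comap]
          refine Subgroup.topologicalClosure_minimal _ ?_ ?_
          · rw [Subgroup.zpowers_le, Subgroup.mem_comap, hred]
            exact Subgroup.mem_zpowers _
          · refine Subgroup.isClosed_of_isOpen _ (Subgroup.isOpen_mono
              (H₁ := principalUnits 2 (if (2 : ℕ) = 2 then 2 else 1 : ℕ)) ?_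
              (isOpen_principalUnits _))
            intro y hy
            rw [Subgroup.mem_comap, mem_principalUnits_coe.1 hy]
            exact one_mem _
        · rw [Subgroup.zpowers_le, ← hred]
          exact Subgroup.mem_map_of_mem _ hmem
      · refine unitInvM_eq hm' ?_ ?_
        · refine Subgroup.topologicalClosure_minimal _ ?_ ?_
          · rw [Subgroup.zpowers_le, hxe]
            exact Subgroup.mul_mem_sup hneg hxu
          · induction m with
            | top =>
              have : principalUnits 2 ⊤ = ⊥ := by
                rw [eq_bot_iff]
                intro y hy
                rw [mem_principalUnits, ellPow_top, zero_dvd_iff, sub_eq_zero] at hy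
                exact Units.ext hy
              rw [this, sup_bot_eq]
              have : Finite (torsionUnits 2) := inferInstanceAs (Finite (rootsOfUnity 2 ℤ_[2]))
              exact (Set.toFinite (torsionUnits 2 : Set ℤ_[2]ˣ)).isClosed
            | coe n =>
              exact Subgroup.isClosed_of_isOpen _ (Subgroup.isOpen_mono le_sup_right
                (isOpen_principalUnits n))
        · rintro n rfl
          obtain ⟨u, hu0, hu, hu'⟩ := exists_unit (ℓ := 2) (-1) (Or.inr rfl) (n := n) (hn1 n rfl)
          refine ⟨-1, hneg, u, hu, hu', ?_⟩
          have : -1 * u = x := by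
            ext1
            rw [hx, Units.val_mul, hu0, ellPow_coe]
            simp; ring
          rw [this]
          exact hmem
    · constructor
      · rw [unitInvT, Subgroup.map_sup, map_principalUnits hm', sup_bot_eq, MonoidHom.map_zpowers]
        exact hcard
      · refine unitInvM_eq hm' (sup_le_sup_right (by rwa [Subgroup.zpowers_le]) _) ?_
        rintro n rfl
        obtain ⟨u, -, hu, hu'⟩ := exists_unit (ℓ := 2) 1 (Or.inl rfl) (n := n) (hn1 n rfl)
        exact ⟨1, one_mem _, u, hu, hu', by rw [one_mul]; exact Subgroup.mem_sup_right hu⟩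

end Agree

/-! Write `K` for the algebraic closure and `X = ℤⁿ` for the character lattice of `T` over `K`. A
Galois element `g` acts on `X` by an endomorphism `ρ` of finite order. Let `B` be a subgroup of `A`
of order `ℓ ^ v`, `v = v_ℓ(A)`. Its points pair with `X` into the `ℓ ^ v`-th roots of unity, where
`g` is raising to an integer power `y ≡ χ(g)`. Hence every `b ∈ B` is trivial on `(y - ρ)X`. As the
pairing is faithful, `ℓ ^ v` divides `det (y - ρ)`, the value at `y` of the characteristic
polynomial of `ρ` (`pow_dvd_det_of_characters`).

That polynomial is a product of cyclotomic polynomials of total degree `n`. For a well-chosen `g`,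
every `Φ_d` with `ℓ ∣ Φ_d(y)` has degree at least `φ(t)` and, for finite `m`, contributes valuation
at most `m` (`exists_unit_cyclotomic_bound`). At most `n / φ(t)` factors contribute
(`exists_emultiplicity_eval_le`), whence the bound. If `m = ∞`, only the case where no factor
contributes needs an argument. -/

/-! ### Valuations of cyclotomic values at integers -/

-- The prime factors of `p` are associated to polynomials `Φ_d`, and `r` counts, with multiplicity,
-- those with `ℓ ∣ Φ_d(y)`. Each uses at least `w` of the degree and adds at most `M` to the
-- valuation; the others add nothing.
open Polynomial in
theorem exists_emultiplicity_eval_le {ℓ : ℕ} (hℓ : ℓ.Prime) {y : ℤ} {w M N : ℕ} (hN : 0 < N)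
    (h : ∀ d : ℕ, 0 < d → (ℓ : ℤ) ∣ (cyclotomic d ℤ).eval y →
      w ≤ d.totient ∧ emultiplicity (ℓ : ℤ) ((cyclotomic d ℤ).eval y) ≤ M)
    {s : ℕ} (p : ℤ[X]) (hp : p ∣ (X ^ N - 1) ^ s) :
    ∃ r : ℕ, r * w ≤ p.natDegree ∧ emultiplicity (ℓ : ℤ) (p.eval y) ≤ (M * r : ℕ) := by
  have hℓ' : Prime (ℓ : ℤ) := Nat.prime_iff_prime_int.1 hℓ
  have hX : (X ^ N - 1 : ℤ[X]) ≠ 0 := (monic_X_pow_sub_C 1 hN.ne').ne_zero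
  induction p using UniqueFactorizationMonoid.induction_on_prime with
  | h₁ => exact absurd (zero_dvd_iff.1 hp) (pow_ne_zero _ hX)
  | h₂ p hu =>
    refine ⟨0, by simp, ?_⟩
    have : IsUnit (p.eval y) := hu.map (evalRingHom y)
    rw [Nat.mul_zero, Nat.cast_zero, emultiplicity_eq_zero.2]
    intro hd
    exact hℓ'.not_isUnit (isUnit_of_dvd_unit hd this)
  | h₃ a q ha hq ih =>
    obtain ⟨r, hr, hr'⟩ := ih (dvd_trans (dvd_mul_left _ _) hp)
    have hqX : q ∣ X ^ N - 1 := hq.dvd_of_dvd_pow (dvd_trans (dvd_mul_right _ _) hp)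
    rw [← prod_cyclotomic_eq_X_pow_sub_one hN, hq.dvd_finsetProd_iff] at hqX
    obtain ⟨d, hd, hqd⟩ := hqX
    have hd0 : 0 < d := Nat.pos_of_mem_divisors hd
    have has : Associated q (cyclotomic d ℤ) :=
      hq.irreducible.associated_of_dvd (cyclotomic.irreducible hd0) hqd
    have hdeg : q.natDegree = d.totient := by
      rw [← natDegree_cyclotomic d ℤ]
      exact natDegree_eq_of_degree_eq (degree_eq_degree_of_associated has)
    have hem : emultiplicity (ℓ : ℤ) (q.eval y) =
        emultiplicity (ℓ : ℤ) ((cyclotomic d ℤ).eval y) :=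
      emultiplicity_eq_of_associated_right (has.map (evalRingHom y))
    rw [natDegree_mul hq.ne_zero ha, eval_mul, emultiplicity_mul hℓ', hem, hdeg]
    by_cases hdvd : (ℓ : ℤ) ∣ (cyclotomic d ℤ).eval y
    · obtain ⟨h1, h2⟩ := h d hd0 hdvd
      refine ⟨r + 1, by linarith, ?_⟩
      rw [mul_add, mul_one, add_comm, Nat.cast_add]
      exact add_le_add hr' h2
    · refine ⟨r, by omega, ?_⟩
      rw [emultiplicity_eq_zero.2 hdvd, zero_add]
      exact hr'

open Polynomial in
theorem eval_cyclotomic_dvd_geom_sum {e c : ℕ} (he : 0 < e) (hc : 1 < c) (y : ℤ)  :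
    (cyclotomic (e * c) ℤ).eval y ∣ ∑ i ∈ Finset.range c, (y ^ e) ^ i := by
  have h1 : (X ^ e - 1) * cyclotomic (e * c) ℤ ∣ X ^ (e * c) - 1 :=
    X_pow_sub_one_mul_cyclotomic_dvd_X_pow_sub_one_of_dvd ℤ
      (Nat.mem_properDivisors.2 ⟨dvd_mul_right _ _, by nlinarith⟩)
  have h2 : (X ^ (e * c) - 1 : ℤ[X]) = (X ^ e - 1) * ∑ i ∈ Finset.range c, (X ^ e) ^ i := by
    rw [mul_geom_sum, pow_mul]
  have h3 : (X ^ e - 1 : ℤ[X]) ≠ 0 := (monic_X_pow_sub_C 1 he.ne').ne_zero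
  rw [h2, mul_dvd_mul_iff_left h3] at h1
  simpa [eval_finsetSum] using eval_dvd (x := y) h1

open Polynomial in
theorem eval_cyclotomic_dvd_pow_sub_one (d : ℕ) (y : ℤ) :
    (cyclotomic d ℤ).eval y ∣ y ^ d - 1 := by
  simpa using eval_dvd (x := y) (cyclotomic.dvd_X_pow_sub_one d ℤ)

theorem not_dvd_geom_sum_of_dvd_sub_one {p : ℤ} (hp : Prime p) {z : ℤ} (hz : p ∣ z - 1) {c : ℕ}
    (hc : ¬ p ∣ c) : ¬ p ∣ ∑ i ∈ Finset.range c, z ^ i := by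
  have hz' : ¬ p ∣ z := fun h => hp.not_isUnit (isUnit_of_dvd_one (by
    simpa using dvd_sub h hz))
  simpa using not_dvd_geom_sum₂ hp hz hz' hc

-- Here `t` is the order of `y` modulo `ℓ`, so `d = t * c`. If `c = 1`, then `Φ_d(y)` divides `y ^ t
-- - 1`. If `c = ℓ * b`, it divides `(Y ^ ℓ - 1) / (Y - 1)` with `Y = y ^ (t * b) ≡ 1`, whose
-- valuation is exactly 1. If `c > 1` is prime to `ℓ`, it divides a geometric sum congruent to `c`,
-- which is impossible.
open Polynomial in
theorem cyclotomic_eval_bound_of_odd {ℓ : ℕ} (hℓ : ℓ.Prime) (h2 : ℓ ≠ 2) {y : ℤ} {t M : ℕ}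
    (ht : ∀ d : ℕ, (ℓ : ℤ) ∣ y ^ d - 1 ↔ t ∣ d) (ht0 : 0 < t)
    (hM : emultiplicity (ℓ : ℤ) (y ^ t - 1) ≤ M)
    {d : ℕ} (hd : 0 < d) (h : (ℓ : ℤ) ∣ (cyclotomic d ℤ).eval y) :
    t.totient ≤ d.totient ∧ emultiplicity (ℓ : ℤ) ((cyclotomic d ℤ).eval y) ≤ M := by
  have hℓ' : Prime (ℓ : ℤ) := Nat.prime_iff_prime_int.1 hℓ
  obtain ⟨c, rfl⟩ := (ht d).1 (h.trans (eval_cyclotomic_dvd_pow_sub_one d y))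
  refine ⟨Nat.le_of_dvd (Nat.totient_pos.2 hd) (Nat.totient_dvd_of_dvd (dvd_mul_right _ _)), ?_⟩
  have hc0 : 0 < c := Nat.pos_of_mul_pos_left hd
  obtain rfl | hc1 := (show 1 ≤ c from hc0).eq_or_lt
  · rw [mul_one]
    exact (emultiplicity_le_emultiplicity_of_dvd_right (eval_cyclotomic_dvd_pow_sub_one t y)).trans hM
  have hM1 : (1 : ℕ∞) ≤ M := le_trans (by
    have := pow_dvd_iff_le_emultiplicity.1 (by simpa using (ht t).2 dvd_rfl :
      (ℓ : ℤ) ^ 1 ∣ y ^ t - 1)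
    simpa using this) hM
  by_cases hc : ℓ ∣ c
  · obtain ⟨b, rfl⟩ := hc
    have hb : 0 < b := Nat.pos_of_mul_pos_left hc0
    have h3 : (ℓ : ℤ) ∣ y ^ (t * b) - 1 := (ht _).2 (dvd_mul_right _ _)
    have h4 : ¬ (ℓ : ℤ) ∣ y ^ (t * b) := fun h => hℓ'.not_isUnit (isUnit_of_dvd_one (by
      simpa using dvd_sub h h3))
    have h5 := emultiplicity_geom_sum₂_eq_one hℓ' (hℓ.odd_of_ne_two h2) h3 h4
    have h6 := eval_cyclotomic_dvd_geom_sum (Nat.mul_pos ht0 hb) hℓ.one_lt y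
    rw [show t * (ℓ * b) = t * b * ℓ by ring]
    refine le_trans (emultiplicity_le_emultiplicity_of_dvd_right h6) (le_trans (le_of_eq ?_) hM1)
    simpa using h5
  · exact absurd (h.trans (eval_cyclotomic_dvd_geom_sum ht0 hc1 y))
      (not_dvd_geom_sum_of_dvd_sub_one hℓ' ((ht t).2 dvd_rfl) (by exact_mod_cast hc))

-- The values for `d = 1, 2` are `y - 1` and `y + 1`. If `4 ∣ d`, the value divides 1 plus an odd
-- square, which is 2 modulo 4. Any other `d` has an odd factor `c > 1` for which the value divides
-- a sum of `c` odd terms, so it is odd.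
open Polynomial in
theorem cyclotomic_eval_bound_two {y : ℤ} {M : ℕ} (hy : (2 : ℤ) ∣ y - 1)
    (hM : emultiplicity (2 : ℤ) (y - 1) ≤ M) (hM' : emultiplicity (2 : ℤ) (y + 1) ≤ M)
    {d : ℕ} (hd : 0 < d) (h : (2 : ℤ) ∣ (cyclotomic d ℤ).eval y) :
    emultiplicity (2 : ℤ) ((cyclotomic d ℤ).eval y) ≤ M := by
  have h2 : Prime (2 : ℤ) := Int.prime_two
  have hM1 : (1 : ℕ∞) ≤ M := le_trans (by
    have := pow_dvd_iff_le_emultiplicity.1 (by simpa using hy : (2 : ℤ) ^ 1 ∣ y - 1)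
    simpa using this) hM
  obtain rfl | hd1 := (show 1 ≤ d from hd).eq_or_lt
  · simpa using hM
  obtain ⟨e, he⟩ | hodd := Nat.even_or_odd d
  · obtain rfl : d = e * 2 := by omega
    have he0 : 0 < e := by omega
    obtain rfl | he1 := (show 1 ≤ e from he0).eq_or_lt
    · simpa using hM'
    obtain ⟨b, hb⟩ | hodd := Nat.even_or_odd e
    · obtain rfl : e = b * 2 := by omega
      refine le_trans (emultiplicity_le_emultiplicity_of_dvd_right
        (eval_cyclotomic_dvd_geom_sum he0 one_lt_two y)) (le_trans ?_ hM1)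
      refine Order.le_of_lt_add_one (lt_of_not_ge fun h4 => ?_)
      have h4' : (2 : ℤ) ^ 2 ∣ ∑ i ∈ Finset.range 2, (y ^ (b * 2)) ^ i :=
        pow_dvd_of_le_emultiplicity (by simpa [one_add_one_eq_two] using h4)
      rw [Finset.sum_range_succ, Finset.sum_range_one, pow_zero, pow_one, pow_mul] at h4'
      have hyb : (2 : ℤ) ∣ y ^ b - 1 := hy.trans (by simpa using sub_dvd_pow_sub_pow y 1 b)
      obtain ⟨u, hu⟩ := hyb
      obtain ⟨v, hv⟩ := h4'
      rw [show y ^ b = 2 * u + 1 by omega] at hv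
      have : 1 + (2 * u + 1) ^ 2 = 4 * (u ^ 2 + u) + 2 := by ring
      omega
    · rw [mul_comm] at h ⊢
      exact absurd (h.trans (eval_cyclotomic_dvd_geom_sum two_pos he1 y))
        (not_dvd_geom_sum_of_dvd_sub_one h2 (hy.trans (by simpa using sub_dvd_pow_sub_pow y 1 2))
          (by have := hodd.not_two_dvd_nat; exact_mod_cast this))
  · have := eval_cyclotomic_dvd_geom_sum one_pos hd1 y
    rw [one_mul] at this
    exact absurd (h.trans this)
        (not_dvd_geom_sum_of_dvd_sub_one h2 (by simpa using hy)
          (by have := hodd.not_two_dvd_nat; exact_mod_cast this))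

-- Over `ℤ[X]`, the matrix `X - ρ` divides `X ^ N - ρ ^ N = X ^ N - 1`; take determinants.
open Polynomial in
theorem charpoly_dvd_X_pow_sub_one_pow {n N : ℕ} {ρ : Matrix (Fin n) (Fin n) ℤ} (hρ : ρ ^ N = 1) :
    ρ.charpoly ∣ (X ^ N - 1) ^ n := by
  have hc : Commute (Matrix.scalar (Fin n) (X : ℤ[X])) (ρ.map C) :=
    Matrix.scalar_commute _ (fun _ => Commute.all _ _) _
  have h1 : Matrix.charmatrix ρ ∣ Matrix.scalar (Fin n) (X : ℤ[X]) ^ N - ρ.map C ^ N :=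
    hc.sub_dvd_pow_sub_pow N
  have h2 : Matrix.scalar (Fin n) (X : ℤ[X]) ^ N - ρ.map C ^ N =
      Matrix.scalar (Fin n) (X ^ N - 1 : ℤ[X]) := by
    have : ρ.map (C : ℤ →+* ℤ[X]) ^ N = 1 := by
      rw [← RingHom.mapMatrix_apply, ← map_pow, hρ, map_one]
    rw [this, map_sub, map_pow, map_one]
  rw [h2] at h1
  obtain ⟨D, hD⟩ := h1
  have := congrArg Matrix.det hD
  rw [Matrix.det_mul] at this
  exact ⟨D.det, by simpa [Matrix.charpoly] using this⟩

/-! ### Choice of an extremal `ℓ`-adic unit -/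

/-- The quotient `(u ^ j - 1) / (u - 1)` is a geometric sum congruent to `j` modulo `ℓ`, hence a
unit. -/
theorem mem_principalUnits_of_pow_mem {ℓ : ℕ} [Fact ℓ.Prime] {u : ℤ_[ℓ]ˣ}
    (hu : u ∈ principalUnits ℓ (1 : ℕ)) {j : ℕ} (hj : ¬ ℓ ∣ j) {d : ℕ}
    (h : u ^ j ∈ principalUnits ℓ d) : u ∈ principalUnits ℓ d := by
  rw [mem_principalUnits, ellPow_coe] at *
  rw [pow_one] at hu
  rw [Units.val_pow_eq_pow_val] at h
  have h1 : ¬ (ℓ : ℤ_[ℓ]) ∣ ∑ i ∈ Finset.range j, (u : ℤ_[ℓ]) ^ i := by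
    have hj' : ¬ (ℓ : ℤ_[ℓ]) ∣ (j : ℤ_[ℓ]) := by
      have := PadicInt.pow_p_dvd_int_iff (p := ℓ) 1 (j : ℤ)
      rw [pow_one, pow_one, Int.natCast_dvd_natCast] at this
      intro h
      exact hj (this.1 (by simpa using h))
    have h2 : ¬ (ℓ : ℤ_[ℓ]) ∣ (u : ℤ_[ℓ]) := fun h =>
      PadicInt.prime_p.not_isUnit (isUnit_of_dvd_unit h u.isUnit)
    simpa using not_dvd_geom_sum₂ PadicInt.prime_p hu h2 hj'
  rw [← geom_sum_mul] at h
  exact PadicInt.prime_p.pow_dvd_of_dvd_mul_left d h1 h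

theorem pow_sub_one_mem_principalUnits {ℓ : ℕ} [Fact ℓ.Prime] (x : ℤ_[ℓ]ˣ) :
    x ^ (ℓ - 1) ∈ principalUnits ℓ (1 : ℕ) := by
  rw [mem_principalUnits_coe, map_pow]
  have h := ZMod.pow_totient (n := ℓ ^ 1)
    (Units.map (PadicInt.toZModPow (p := ℓ) 1).toMonoidHom x)
  have h1 : (ℓ ^ 1).totient = ℓ - 1 := by rw [pow_one, Nat.totient_prime Fact.out]
  rwa [h1] at h

/-- The Teichmüller decomposition: `x` is an approximate root of `X ^ (ℓ - 1) - 1` with unit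
derivative, and Hensel's lemma gives `c`. -/
theorem exists_torsion_mul_principal {ℓ : ℕ} [Fact ℓ.Prime] (h2 : ℓ ≠ 2) (x : ℤ_[ℓ]ˣ) :
    ∃ c ∈ torsionUnits ℓ, ∃ u ∈ principalUnits ℓ (1 : ℕ), x = c * u := by
  have hℓ : ℓ.Prime := Fact.out
  have hx := pow_sub_one_mem_principalUnits x
  have key (z : ℤ_[ℓ]) : ‖z‖ < 1 ↔ (ℓ : ℤ_[ℓ]) ∣ z := PadicInt.norm_lt_one_iff_dvd z
  let F : Polynomial ℤ_[ℓ] := Polynomial.X ^ (ℓ - 1) - 1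
  have hF : ‖Polynomial.aeval (x : ℤ_[ℓ]) F‖ < ‖Polynomial.aeval (x : ℤ_[ℓ]) F.derivative‖ ^ 2 := by
    have h1 : ‖Polynomial.aeval (x : ℤ_[ℓ]) F.derivative‖ = 1 := by
      simp only [F, Polynomial.derivative_sub, Polynomial.derivative_X_pow,
        Polynomial.derivative_one, sub_zero, map_mul, map_pow, Polynomial.aeval_X, norm_mul,
        norm_pow, PadicInt.norm_units, one_pow, mul_one]
      simp
    rw [h1, one_pow, key]
    rw [mem_principalUnits, ellPow_coe, pow_one] at hx
    simpa [F] using hx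
  obtain ⟨z, hz, hzx, -⟩ := hensels_lemma hF
  have hz1 : z ^ (ℓ - 1) = 1 := by simpa [F, sub_eq_zero] using hz
  have hl : ℓ - 1 ≠ 0 := by have := hℓ.two_le; omega
  let c : ℤ_[ℓ]ˣ := Units.ofPowEqOne z (ℓ - 1) hz1 hl
  have hc : (c : ℤ_[ℓ]) = z := rfl
  refine ⟨c, ?_, c⁻¹ * x, ?_, by simp⟩
  · rw [torsionUnits, if_neg h2, mem_rootsOfUnity]
    exact Units.ext (by rw [Units.val_pow_eq_pow_val, hc, hz1, Units.val_one])
  · have h3 : ‖z - x‖ < 1 := hzx.trans_le (PadicInt.norm_le_one _)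
    rw [key] at h3
    rw [mem_principalUnits, ellPow_coe, pow_one, ← dvd_neg]
    have : -(((c⁻¹ * x : ℤ_[ℓ]ˣ) : ℤ_[ℓ]) - 1) = ((c⁻¹ : ℤ_[ℓ]ˣ) : ℤ_[ℓ]) * (z - x) := by
      rw [← hc, mul_sub, Units.inv_mul]; push_cast; ring
    rw [this]
    exact h3.mul_left _

theorem exists_notMem_of_unitInvM_eq {ℓ : ℕ} [Fact ℓ.Prime] {I : Subgroup ℤ_[ℓ]ˣ} {m : ℕ}
    (h : unitInvM I = m) : ∃ z ∈ I, z ∉ torsionUnits ℓ ⊔ principalUnits ℓ (m + 1 : ℕ) := by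
  by_contra! hc
  have : ((m + 1 : ℕ) : ℕ∞) ≤ unitInvM I := le_sSup hc
  rw [h] at this
  have := Nat.cast_le.1 this
  omega

theorem unitInvT_pos {ℓ : ℕ} [Fact ℓ.Prime] (I : Subgroup ℤ_[ℓ]ˣ) : 0 < unitInvT I := by
  unfold unitInvT
  have : NeZero ℓ := ⟨(Fact.out : ℓ.Prime).ne_zero⟩
  exact Nat.card_pos

/-- Lift a generator of the cyclic image of `I` modulo `ℓ`. If its `t`-th power is too close to 1,
multiply by `z ^ (ℓ - 1)`, where `z ∈ I` witnesses the maximality of `m`. This keeps the residue,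
and since `t` and `ℓ - 1` are prime to `ℓ`, the new `t`-th power is at the right distance from 1. -/
theorem exists_unit_of_odd {ℓ : ℕ} [Fact ℓ.Prime] (h2 : ℓ ≠ 2) (I : Subgroup ℤ_[ℓ]ˣ) :
    ∃ x ∈ I, (∀ d : ℕ, x ^ d ∈ principalUnits ℓ (1 : ℕ) ↔ unitInvT I ∣ d) ∧
      ∀ m : ℕ, unitInvM I = m → x ^ unitInvT I ∉ principalUnits ℓ (m + 1 : ℕ) := by
  have hℓ : ℓ.Prime := Fact.out
  obtain ⟨x, hx, hxd⟩ : ∃ x ∈ I, ∀ d : ℕ, x ^ d ∈ principalUnits ℓ (1 : ℕ) ↔ unitInvT I ∣ d := by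
    let f := Units.map (PadicInt.toZModPow (p := ℓ) (if ℓ = 2 then 2 else 1)).toMonoidHom
    have hcyc : IsCyclic (I.map f) := by
      have : IsCyclic (ZMod (ℓ ^ (if ℓ = 2 then 2 else 1)))ˣ := by
        rw [if_neg h2, pow_one]; infer_instance
      infer_instance
    obtain ⟨⟨_, x, hx, rfl⟩, hg⟩ := hcyc.exists_generator
    refine ⟨x, hx, fun d => ?_⟩
    have h1 : unitInvT I = orderOf (f x) := by
      rw [← Subgroup.orderOf_mk (f x) (Subgroup.mem_map_of_mem f hx)]
      exact (orderOf_eq_card_of_forall_mem_zpowers hg).symm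
    rw [h1, orderOf_dvd_iff_pow_eq_one, mem_principalUnits_coe, ← map_pow]
    have he : (if ℓ = 2 then 2 else 1) = 1 := if_neg h2
    change _ ↔ Units.map (PadicInt.toZModPow (p := ℓ) _).toMonoidHom _ = 1
    rw [← mem_principalUnits_coe, ← mem_principalUnits_coe, he]
  have hcop : ¬ ℓ ∣ unitInvT I := by
    intro hd
    have h3 := Nat.le_of_dvd (by have := hℓ.two_le; omega)
      (hd.trans ((hxd _).1 (pow_sub_one_mem_principalUnits x)))
    have := hℓ.two_le
    omega
  by_cases htop : ∃ m : ℕ, unitInvM I = m ∧ x ^ unitInvT I ∈ principalUnits ℓ (m + 1 : ℕ)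
  swap
  · exact ⟨x, hx, hxd, fun m hm hmem => htop ⟨m, hm, hmem⟩⟩
  obtain ⟨m, hm, hxm⟩ := htop
  obtain ⟨z, hz, hzm⟩ := exists_notMem_of_unitInvM_eq hm
  have hz1 := pow_sub_one_mem_principalUnits z
  refine ⟨x * z ^ (ℓ - 1), mul_mem hx (pow_mem hz _), fun d => ?_, fun m' hm' hmem => hzm ?_⟩
  · rw [mul_pow, Subgroup.mul_mem_cancel_right _ (pow_mem hz1 d), hxd]
  obtain rfl : m = m' := by rw [hm] at hm'; exact_mod_cast hm'
  rw [mul_pow, Subgroup.mul_mem_cancel_left _ hxm] at hmem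
  have h3 := mem_principalUnits_of_pow_mem hz1 hcop hmem
  obtain ⟨c, hc, u, hu, rfl⟩ := exists_torsion_mul_principal h2 z
  have hc1 : c ^ (ℓ - 1) = 1 := by
    rwa [torsionUnits, if_neg h2, mem_rootsOfUnity] at hc
  rw [mul_pow, hc1, one_mul] at h3
  refine Subgroup.mul_mem_sup hc (mem_principalUnits_of_pow_mem hu (fun hd => ?_) h3)
  have := Nat.le_of_dvd (by have := hℓ.two_le; omega) hd
  have := hℓ.two_le
  omega

theorem exists_unit_of_two (I : Subgroup ℤ_[2]ˣ) :
    ∃ x ∈ I, ∀ m : ℕ, unitInvM I = m →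
      x ∉ principalUnits 2 (m + 1 : ℕ) ∧ -x ∉ principalUnits 2 (m + 1 : ℕ) := by
  by_cases htop : ∃ m : ℕ, unitInvM I = m
  swap
  · exact ⟨1, one_mem _, fun m hm => absurd ⟨m, hm⟩ htop⟩
  obtain ⟨m, hm⟩ := htop
  obtain ⟨z, hz, hzm⟩ := exists_notMem_of_unitInvM_eq hm
  refine ⟨z, hz, fun m' hm' => ?_⟩
  obtain rfl : m = m' := by rw [hm] at hm'; exact_mod_cast hm'
  refine ⟨fun h => hzm (Subgroup.mem_sup_right h), fun h => hzm ?_⟩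
  have hneg : (-1 : ℤ_[2]ˣ) ∈ torsionUnits 2 := by simp [torsionUnits, mem_rootsOfUnity]
  simpa using Subgroup.mul_mem_sup hneg h

/-- `(ℤ/4)ˣ` has order 2 and `φ(1) = φ(2) = 1`, so the degree condition is automatic at `ℓ = 2`. -/
theorem totient_unitInvT_two (I : Subgroup ℤ_[2]ˣ) : (unitInvT I).totient = 1 := by
  have h : unitInvT I ∣ 2 := by
    have := Subgroup.card_subgroup_dvd_card (I.map (Units.map
      (PadicInt.toZModPow (p := 2) (if (2 : ℕ) = 2 then 2 else 1)).toMonoidHom))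
    rw [Nat.card_eq_fintype_card (α := (ZMod _)ˣ), ZMod.card_units_eq_totient] at this
    exact this
  obtain h | h := (Nat.dvd_prime Nat.prime_two).1 h <;> simp [h]

/-! ### From `ℓ`-adic units to integers -/

theorem emultiplicity_le_of_not_pow_dvd {p a : ℤ} {m : ℕ} (h : ¬ p ^ (m + 1) ∣ a) :
    emultiplicity p a ≤ m := by
  refine Order.le_of_lt_add_one ?_
  exact_mod_cast emultiplicity_lt_iff_not_dvd.2 h

theorem exists_emultiplicity_le {ℓ : ℕ} (hℓ : ℓ.Prime) {a : ℤ} (ha : a ≠ 0) :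
    ∃ M : ℕ, emultiplicity (ℓ : ℤ) a ≤ M := by
  have : FiniteMultiplicity (ℓ : ℤ) a :=
    Int.finiteMultiplicity_iff.2 ⟨by simpa using hℓ.ne_one, ha⟩
  exact ⟨_, this.emultiplicity_eq_multiplicity.le⟩

theorem dvd_intCast_sub_one_iff {ℓ : ℕ} [Fact ℓ.Prime] {x : ℤ_[ℓ]ˣ} {y : ℤ} {S d e : ℕ}
    (hy : (ℓ : ℤ_[ℓ]) ^ S ∣ (y : ℤ_[ℓ]) - x) (he : e ≤ S) :
    (ℓ : ℤ) ^ e ∣ y ^ d - 1 ↔ x ^ d ∈ principalUnits ℓ e := by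
  rw [← PadicInt.pow_p_dvd_int_iff, mem_principalUnits, ellPow_coe]
  push_cast
  refine (dvd_iff_dvd_of_dvd_sub ?_)
  have := ((pow_dvd_pow _ he).trans hy).trans (sub_dvd_pow_sub_pow (y : ℤ_[ℓ]) x d)
  simpa using this

-- Precision `S ≥ m + 1` lets `y` inherit the failure of divisibility by `ℓ ^ (m + 1)` from `x`. For
-- infinite `m` some finite `M` still exists, because `y ≥ 2` makes the relevant integers nonzero.
open Polynomial in
theorem exists_unit_cyclotomic_bound {ℓ : ℕ} [Fact ℓ.Prime] (I : Subgroup ℤ_[ℓ]ˣ) {S : ℕ}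
    (hS1 : 1 ≤ S) (hS : ∀ m : ℕ, unitInvM I = m → m + 1 ≤ S) :
    ∃ x ∈ I, ∀ y : ℤ, 2 ≤ y → (ℓ : ℤ_[ℓ]) ^ S ∣ (y : ℤ_[ℓ]) - x →
      ∃ M : ℕ, (∀ m : ℕ, unitInvM I = m → M = m) ∧ ∀ d : ℕ, 0 < d →
        (ℓ : ℤ) ∣ (cyclotomic d ℤ).eval y → (unitInvT I).totient ≤ d.totient ∧
          emultiplicity (ℓ : ℤ) ((cyclotomic d ℤ).eval y) ≤ M := by
  have hℓ : ℓ.Prime := Fact.out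
  obtain rfl | h2 := eq_or_ne ℓ 2
  · obtain ⟨x, hx, hxm⟩ := exists_unit_of_two I
    refine ⟨x, hx, fun y hy2 hy => ?_⟩
    obtain ⟨M, hMm, hM, hM'⟩ : ∃ M : ℕ, (∀ m : ℕ, unitInvM I = m → M = m) ∧
        emultiplicity (2 : ℤ) (y - 1) ≤ M ∧ emultiplicity (2 : ℤ) (y + 1) ≤ M := by
      by_cases htop : ∃ m : ℕ, unitInvM I = m
      · obtain ⟨m, hm⟩ := htop
        refine ⟨m, fun m' hm' => by rw [hm] at hm'; exact_mod_cast hm',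
          emultiplicity_le_of_not_pow_dvd fun h => (hxm m hm).1 ?_,
          emultiplicity_le_of_not_pow_dvd fun h => (hxm m hm).2 ?_⟩
        · simpa using (dvd_intCast_sub_one_iff (d := 1) hy (hS m hm)).1 (by simpa using h)
        · have hy' : ((2 : ℕ) : ℤ_[2]) ^ S ∣ ((-y : ℤ) : ℤ_[2]) - (-x : ℤ_[2]ˣ) := by
            rw [← dvd_neg]; convert! hy using 1; push_cast; ring
          simpa using (dvd_intCast_sub_one_iff (d := 1) hy' (hS m hm)).1 (by
            rw [← dvd_neg]; convert! h using 1; ring)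
      · obtain ⟨M, hM⟩ := exists_emultiplicity_le Nat.prime_two (show y - 1 ≠ 0 by omega)
        obtain ⟨M', hM'⟩ := exists_emultiplicity_le Nat.prime_two (show y + 1 ≠ 0 by omega)
        exact ⟨max M M', fun m hm => absurd ⟨m, hm⟩ htop,
          hM.trans (by exact_mod_cast le_max_left _ _), hM'.trans (by exact_mod_cast le_max_right _ _)⟩
    have hy1 : (2 : ℤ) ∣ y - 1 := by
      simpa using (dvd_intCast_sub_one_iff (d := 1) hy hS1).2
        (by simpa using pow_sub_one_mem_principalUnits x)
    refine ⟨M, hMm, fun d hd h => ⟨?_, cyclotomic_eval_bound_two hy1 hM hM' hd h⟩⟩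
    rw [totient_unitInvT_two]
    exact Nat.totient_pos.2 hd
  · obtain ⟨x, hx, hxt, hxm⟩ := exists_unit_of_odd h2 I
    refine ⟨x, hx, fun y hy2 hy => ?_⟩
    have ht0 := unitInvT_pos I
    have ht (d : ℕ) : (ℓ : ℤ) ∣ y ^ d - 1 ↔ unitInvT I ∣ d := by
      rw [← hxt, ← dvd_intCast_sub_one_iff hy hS1, pow_one]
    obtain ⟨M, hMm, hM⟩ : ∃ M : ℕ, (∀ m : ℕ, unitInvM I = m → M = m) ∧
        emultiplicity (ℓ : ℤ) (y ^ unitInvT I - 1) ≤ M := by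
      by_cases htop : ∃ m : ℕ, unitInvM I = m
      · obtain ⟨m, hm⟩ := htop
        exact ⟨m, fun m' hm' => by rw [hm] at hm'; exact_mod_cast hm',
          emultiplicity_le_of_not_pow_dvd fun h =>
            hxm m hm ((dvd_intCast_sub_one_iff hy (hS m hm)).1 h)⟩
      · obtain ⟨M, hM⟩ := exists_emultiplicity_le hℓ (a := y ^ unitInvT I - 1)
          (by have := one_lt_pow₀ (show 1 < y by omega) ht0.ne'; omega)
        exact ⟨M, fun m hm => absurd ⟨m, hm⟩ htop, hM⟩
    exact ⟨M, hMm, fun d hd h => cyclotomic_eval_bound_of_odd hℓ h2 ht ht0 hM hd h⟩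

/-! ### Semilinear Galois action on the coordinate ring -/

section GaloisAction

variable {k K H : Type*} [Field k] [Field K] [Algebra k K] [CommRing H] [HopfAlgebra k H]

variable (H) in
/-- The semilinear action of `g` on the base change `K ⊗ H`, through the first factor. -/
noncomputable def baseChangeAct (g : K →ₐ[k] K) : K ⊗[k] H →ₐ[k] K ⊗[k] H :=
  Algebra.TensorProduct.map g (AlgHom.id k H)

@[simp] theorem baseChangeAct_tmul (g : K →ₐ[k] K) (c : K) (h : H) :
    baseChangeAct H g (c ⊗ₜ h) = g c ⊗ₜ h := rfl

variable (H) in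
/-- The semilinear action of `g` on `(K ⊗ H) ⊗ (K ⊗ H)`. -/
noncomputable def baseChangeActTensor (g : K →ₐ[k] K) :
    (K ⊗[k] H) ⊗[K] (K ⊗[k] H) →+* (K ⊗[k] H) ⊗[K] (K ⊗[k] H) :=
  Algebra.TensorProduct.mapRingHom (g : K →+* K) (baseChangeAct H g : K ⊗[k] H →+* K ⊗[k] H)
    (baseChangeAct H g : K ⊗[k] H →+* K ⊗[k] H)
    (by ext; simp [Algebra.TensorProduct.algebraMap_apply])
    (by ext; simp [Algebra.TensorProduct.algebraMap_apply])

@[simp] theorem baseChangeActTensor_tmul (g : K →ₐ[k] K) (x y : K ⊗[k] H) :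
    baseChangeActTensor H g (x ⊗ₜ y) = baseChangeAct H g x ⊗ₜ baseChangeAct H g y := by
  simp [baseChangeActTensor]

theorem counit_baseChangeAct (g : K →ₐ[k] K) (x : K ⊗[k] H) :
    Coalgebra.counit (R := K) (baseChangeAct H g x) = g (Coalgebra.counit (R := K) x) := by
  induction x with
  | zero => simp
  | add x y hx hy => simp [hx, hy]
  | tmul a h => simp

theorem comul_baseChangeAct (g : K →ₐ[k] K) (x : K ⊗[k] H) :
    Coalgebra.comul (R := K) (baseChangeAct H g x) =
      baseChangeActTensor H g (Coalgebra.comul (R := K) x) := by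
  induction x with
  | zero => simp
  | add x y hx hy => simp [hx, hy]
  | tmul a h =>
    simp only [baseChangeAct_tmul, TensorProduct.comul_tmul, CommSemiring.comul_apply]
    induction Coalgebra.comul (R := k) h with
    | zero => simp
    | add x y hx hy => simp [TensorProduct.tmul_add, hx, hy]
    | tmul u v => simp

/-- The coalgebra structure comes from `k`, so it commutes with the action of `g` on scalars. -/
theorem IsGroupLikeElem.baseChangeAct (g : K →ₐ[k] K) {x : K ⊗[k] H} (hx : IsGroupLikeElem K x) :
    IsGroupLikeElem K (baseChangeAct H g x) where
  counit_eq_one := by rw [counit_baseChangeAct, hx.counit_eq_one, map_one]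
  comul_eq_tmul_self := by
    rw [comul_baseChangeAct, hx.comul_eq_tmul_self, baseChangeActTensor_tmul]

/-- The `K`-point of the base change defined by a rational point. -/
noncomputable def RationalPoints.baseChange (K : Type*) [Field K] [Algebra k K]
    (p : RationalPoints k H) : K ⊗[k] H →ₐ[K] K :=
  Algebra.TensorProduct.lift (AlgHom.id K K) ((Algebra.ofId k K).comp p.ofConv)
    (fun _ _ => Commute.all _ _)

@[simp] theorem RationalPoints.baseChange_tmul (p : RationalPoints k H) (c : K) (h : H) :
    p.baseChange K (c ⊗ₜ h) = c * algebraMap k K (p h) := rfl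

theorem RationalPoints.baseChange_baseChangeAct (p : RationalPoints k H) (g : K →ₐ[k] K)
    (x : K ⊗[k] H) : p.baseChange K (_root_.baseChangeAct H g x) = g (p.baseChange K x) := by
  induction x with
  | zero => simp
  | add x y hx hy => simp [hx, hy]
  | tmul a h => simp

theorem RationalPoints.baseChange_injective :
    Function.Injective (RationalPoints.baseChange (k := k) (H := H) K) := by
  intro p q hpq
  refine WithConv.ext (AlgHom.ext fun h => (algebraMap k K).injective ?_)
  simpa using congrArg (fun f => f ((1 : K) ⊗ₜ h)) hpq

theorem RationalPoints.baseChange_one_apply {x : K ⊗[k] H} (hx : IsGroupLikeElem K x) :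
    (1 : RationalPoints k H).baseChange K x = 1 := by
  rw [← hx.counit_eq_one]
  clear hx
  induction x with
  | zero => simp
  | add x y hx hy => simp [hx, hy]
  | tmul a h => simp [Algebra.smul_def, mul_comm]

theorem RationalPoints.baseChange_mul_apply (p q : RationalPoints k H) {x : K ⊗[k] H}
    (hx : IsGroupLikeElem K x) :
    (p * q).baseChange K x = p.baseChange K x * q.baseChange K x := by
  have key : ∀ x : K ⊗[k] H, (p * q).baseChange K x =
      Algebra.TensorProduct.lift (p.baseChange K) (q.baseChange K) (fun _ _ => Commute.all _ _)
        (Coalgebra.comul (R := K) x) := by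
    intro x
    induction x with
    | zero => simp
    | add x y hx hy => simp [hx, hy]
    | tmul a h =>
      simp only [RationalPoints.baseChange_tmul, TensorProduct.comul_tmul,
        CommSemiring.comul_apply, AlgHom.convMul_apply]
      induction Coalgebra.comul (R := k) h with
      | zero => simp
      | add x y hx hy => simp [TensorProduct.tmul_add, mul_add, hx, hy]
      | tmul u v => simp [mul_left_comm]
  rw [key, hx.comul_eq_tmul_self, Algebra.TensorProduct.lift_tmul]

/-- Pigeonhole: the iterates of `c` are roots of its minimal polynomial. -/
theorem exists_iterate_eq_self [Algebra.IsAlgebraic k K] (g : K ≃ₐ[k] K) (c : K) :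
    ∃ N : ℕ, 0 < N ∧ (g ^ N) c = c := by
  have hfin : {z : K | Polynomial.aeval z (minpoly k c) = 0}.Finite :=
    (Polynomial.rootSet_finite (minpoly k c) K).subset fun z hz =>
      (Polynomial.mem_rootSet.2 ⟨minpoly.ne_zero (Algebra.IsIntegral.isIntegral c), hz⟩)
  have hmem (i : ℕ) : (g ^ i) c ∈ {z : K | Polynomial.aeval z (minpoly k c) = 0} := by
    simp only [Set.mem_ofPred_eq]
    rw [Polynomial.aeval_algHom_apply, minpoly.aeval, map_zero]
  obtain ⟨i, j, hij, h⟩ := hfin.exists_lt_map_eq_of_forall_mem hmem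
  refine ⟨j - i, by omega, (g ^ i).injective ?_⟩
  rw [← AlgEquiv.mul_apply, ← pow_add, h]
  congr 2; omega

theorem baseChangeAct_pow_succ (g : K ≃ₐ[k] K) (N : ℕ) (x : K ⊗[k] H) :
    baseChangeAct H ((g ^ (N + 1) : K ≃ₐ[k] K) : K →ₐ[k] K) x =
      baseChangeAct H (g : K →ₐ[k] K)
        (baseChangeAct H ((g ^ N : K ≃ₐ[k] K) : K →ₐ[k] K) x) := by
  induction x with
  | zero => simp
  | add x y hx hy => simp [hx, hy]
  | tmul a h => simp [pow_succ']

theorem exists_pow_baseChangeAct_eq_self [Algebra.IsAlgebraic k K] (g : K ≃ₐ[k] K) (x : K ⊗[k] H) :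
    -- All multiples of `N` are included so that the periods of several tensors can be combined by
    -- taking their product.
    ∃ N : ℕ, 0 < N ∧ ∀ M : ℕ, N ∣ M →
      baseChangeAct H ((g ^ M : K ≃ₐ[k] K) : K →ₐ[k] K) x = x := by
  induction x with
  | zero => exact ⟨1, one_pos, by simp⟩
  | add x y hx hy =>
    obtain ⟨N, hN, hx⟩ := hx
    obtain ⟨N', hN', hy⟩ := hy
    exact ⟨N * N', Nat.mul_pos hN hN', fun M hM => by
      rw [map_add, hx M (dvd_of_mul_right_dvd hM), hy M (dvd_of_mul_left_dvd hM)]⟩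
  | tmul a h =>
    obtain ⟨N, hN, ha⟩ := exists_iterate_eq_self g a
    refine ⟨N, hN, ?_⟩
    rintro _ ⟨M, rfl⟩
    have : ((g ^ N) ^ M) a = a := by
      induction M with
      | zero => simp
      | succ M ih => rw [pow_succ, AlgEquiv.mul_apply, ha, ih]
    simp [pow_mul, this]

end GaloisAction

/-! ### Characters of the torus and the pairing -/

section Characters

variable {k K H : Type*} [Field k] [Field K] [Algebra k K] [CommRing H] [HopfAlgebra k H]
  {X : Type*} [AddCommGroup X] (e : K ⊗[k] H ≃ₐc[K] AddMonoidAlgebra K X)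

theorem isGroupLikeElem_symm_of (a : Multiplicative X) :
    IsGroupLikeElem K (e.symm (AddMonoidAlgebra.of K X a)) :=
  (AddMonoidAlgebra.isGroupLikeElem_of a.toAdd).map e.symm

/-- The pairing of the rational points of a split group with its characters. -/
noncomputable def RationalPoints.pairing : RationalPoints k H →* (Multiplicative X →* K) where
  toFun p :=
    { toFun a := p.baseChange K (e.symm (AddMonoidAlgebra.of K X a))
      map_one' := by rw [map_one, map_one, map_one]
      map_mul' a b := by simp only [map_mul] }
  map_one' := by
    ext a
    exact RationalPoints.baseChange_one_apply (isGroupLikeElem_symm_of e a)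
  map_mul' p q := by
    ext a
    exact RationalPoints.baseChange_mul_apply p q (isGroupLikeElem_symm_of e a)

theorem RationalPoints.pairing_apply (p : RationalPoints k H) (a : Multiplicative X) :
    RationalPoints.pairing e p a = p.baseChange K (e.symm (AddMonoidAlgebra.of K X a)) := rfl

theorem RationalPoints.pairing_injective : Function.Injective (RationalPoints.pairing e) := by
  intro p q h
  apply RationalPoints.baseChange_injective (K := K)
  have h1 : (p.baseChange K).comp (e.symm : AddMonoidAlgebra K X →ₐ[K] K ⊗[k] H) =
      (q.baseChange K).comp (e.symm : AddMonoidAlgebra K X →ₐ[K] K ⊗[k] H) :=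
    AddMonoidAlgebra.algHom_ext (fun a => DFunLike.congr_fun h (.ofAdd a)) (Subsingleton.elim _ _)
  ext h
  simpa using congrArg (fun f => f (e (1 ⊗ₜ h))) h1

/-- The group-like elements of `K[X]` are exactly the monomials, so `g` maps monomials to monomials;
multiplicativity of the action makes `ρ` additive. -/
theorem exists_character_act (g : K →ₐ[k] K) : ∃ ρ : X →+ X, ∀ a : X,
    baseChangeAct H g (e.symm (AddMonoidAlgebra.of K X (.ofAdd a))) =
      e.symm (AddMonoidAlgebra.of K X (.ofAdd (ρ a))) := by
  have h (a : X) : ∃ b : X, baseChangeAct H g (e.symm (AddMonoidAlgebra.of K X (.ofAdd a))) =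
      e.symm (AddMonoidAlgebra.of K X (.ofAdd b)) := by
    have h1 := ((isGroupLikeElem_symm_of e (.ofAdd a)).baseChangeAct g).map e
    obtain ⟨b, hb⟩ := AddMonoidAlgebra.isGroupLikeElem_iff_mem_range_of.1 h1
    exact ⟨b.toAdd, by rw [ofAdd_toAdd, hb]; simp⟩
  choose ρ hρ using h
  refine ⟨AddMonoidHom.mk' ρ fun a b => ?_, hρ⟩
  have h2 : AddMonoidAlgebra.of K X (.ofAdd (ρ (a + b))) =
      AddMonoidAlgebra.of K X (.ofAdd (ρ a + ρ b)) := by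
    apply EquivLike.injective e.symm
    rw [← hρ, ofAdd_add, ofAdd_add, map_mul, map_mul, map_mul, hρ, hρ, map_mul, map_mul]
  exact AddMonoidAlgebra.of_injective h2

theorem pairing_character_act {g : K →ₐ[k] K} {ρ : X →+ X} (hρ : ∀ a : X,
    baseChangeAct H g (e.symm (AddMonoidAlgebra.of K X (.ofAdd a))) =
      e.symm (AddMonoidAlgebra.of K X (.ofAdd (ρ a)))) (p : RationalPoints k H) (a : X) :
    RationalPoints.pairing e p (.ofAdd (ρ a)) = g (RationalPoints.pairing e p (.ofAdd a)) := by
  rw [RationalPoints.pairing_apply, ← hρ, RationalPoints.baseChange_baseChangeAct]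
  rfl

/-- Each basis character is fixed by some power of `g`; the product of these exponents works for all
of them. -/
theorem exists_pow_eq_one_of_character_act [Algebra.IsAlgebraic k K] {n : ℕ}
    (e : K ⊗[k] H ≃ₐc[K] AddMonoidAlgebra K (Fin n → ℤ))
    {g : K ≃ₐ[k] K} {ρ : Module.End ℤ (Fin n → ℤ)} (hρ : ∀ a : Fin n → ℤ,
      baseChangeAct H (g : K →ₐ[k] K) (e.symm (AddMonoidAlgebra.of K _ (.ofAdd a))) =
        e.symm (AddMonoidAlgebra.of K _ (.ofAdd (ρ a)))) :
    ∃ N : ℕ, 0 < N ∧ ρ ^ N = 1 := by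
  have hpow (N : ℕ) (a : Fin n → ℤ) : baseChangeAct H ((g ^ N : K ≃ₐ[k] K) : K →ₐ[k] K)
      (e.symm (AddMonoidAlgebra.of K _ (.ofAdd a))) =
        e.symm (AddMonoidAlgebra.of K _ (.ofAdd ((ρ ^ N) a))) := by
    induction N with
    | zero =>
      have : baseChangeAct H ((g ^ 0 : K ≃ₐ[k] K) : K →ₐ[k] K) = AlgHom.id k _ := by
        rw [pow_zero]; exact Algebra.TensorProduct.map_id
      rw [this]; rfl
    | succ N ih => rw [baseChangeAct_pow_succ, ih, hρ, pow_succ', Module.End.mul_apply]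
  choose N hN hN' using fun i : Fin n => exists_pow_baseChangeAct_eq_self (H := H) g
    (e.symm (AddMonoidAlgebra.of K _ (.ofAdd (Pi.single i 1))))
  refine ⟨∏ i, N i, Finset.prod_pos fun i _ => hN i, ?_⟩
  refine (Pi.basisFun ℤ (Fin n)).ext fun i => ?_
  have h1 := hN' i _ (Finset.dvd_prod_of_mem N (Finset.mem_univ i))
  rw [hpow] at h1
  simpa using AddMonoidAlgebra.of_injective (e.symm.injective h1)

end Characters

/-! ### Counting characters of the cokernel -/

open Polynomial in
theorem charpoly_dvd_of_pow_eq_one {n N : ℕ} {ρ : Module.End ℤ (Fin n → ℤ)} (hρ : ρ ^ N = 1) :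
    ρ.charpoly ∣ (X ^ N - 1) ^ n := by
  rw [← LinearMap.charpoly_toMatrix ρ (Pi.basisFun ℤ (Fin n))]
  refine charpoly_dvd_X_pow_sub_one_pow ?_
  rw [LinearMap.toMatrix_pow, hρ, LinearMap.toMatrix_one]

/-- By Dedekind, the characters are linearly independent in the space of functions `Q → K`. -/
theorem card_monoidHom_le (Q K : Type*) [MulOneClass Q] [Finite Q] [Field K] :
    Finite (Q →* K) ∧ Nat.card (Q →* K) ≤ Nat.card Q := by
  have := Fintype.ofFinite Q
  have h := linearIndependent_monoidHom Q K
  have hf : Finite (Q →* K) := h.finite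
  have := Fintype.ofFinite (Q →* K)
  exact ⟨hf, by simpa [Nat.card_eq_fintype_card] using h.fintype_card_le_finrank⟩

theorem card_quotient_range {n : ℕ} {φ : Module.End ℤ (Fin n → ℤ)} (hφ : φ.det ≠ 0) :
    Nat.card ((Fin n → ℤ) ⧸ LinearMap.range φ) = φ.det.natAbs := by
  have hinj : Function.Injective φ := by
    rw [← LinearMap.ker_eq_bot]
    by_contra h
    exact hφ (LinearMap.det_eq_zero_iff_ker_ne_bot.2 h)
  rw [← Submodule.natAbs_det_equiv _ (LinearEquiv.ofInjective φ hinj)]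
  rfl

/-- A family of `ℓ ^ v` characters of `ℤⁿ` of exponent dividing `ℓ ^ v` that are trivial on the
image of `φ` forces `ℓ ^ v` to divide `det φ`. -/
theorem pow_dvd_det_of_characters {ℓ v n : ℕ} (hℓ : ℓ.Prime) {K B : Type*} [Field K] [Finite B]
    (hB : Nat.card B = ℓ ^ v) (χ : B → (Multiplicative (Fin n → ℤ) →* K))
    (hχ : Function.Injective χ) {φ : Module.End ℤ (Fin n → ℤ)}
    (hv : ∀ b a, χ b a ^ ℓ ^ v = 1) (hφ : ∀ b a, χ b (.ofAdd (φ a)) = 1) :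
    (ℓ : ℤ) ^ v ∣ φ.det := by
  obtain h0 | h0 := eq_or_ne φ.det 0
  · simp [h0]
  -- Adding `ℓ ^ v X` to the image of `φ` makes the quotient an `ℓ`-group. Its order is then a power
  -- of `ℓ` dividing `det φ`, so the inequality from counting characters becomes a divisibility.
  let N : AddSubgroup (Fin n → ℤ) := (LinearMap.range φ ⊔
    LinearMap.range (((ℓ ^ v : ℕ) : ℤ) • (1 : Module.End ℤ (Fin n → ℤ)))).toAddSubgroup
  have hle : (LinearMap.range φ).toAddSubgroup ≤ N :=
    Submodule.toAddSubgroup_mono le_sup_left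
  have hdvd : N.index ∣ φ.det.natAbs := by
    rw [← card_quotient_range h0]
    exact AddSubgroup.index_dvd_of_le hle
  have hfin : Finite ((Fin n → ℤ) ⧸ N) := by
    refine Nat.finite_of_card_ne_zero fun h => h0 ?_
    change N.index = 0 at h
    rw [h, zero_dvd_iff] at hdvd
    simpa using hdvd
  have hpg : ∃ j, N.index = ℓ ^ j := by
    have : Fact ℓ.Prime := ⟨hℓ⟩
    have h1 : IsPGroup ℓ (Multiplicative ((Fin n → ℤ) ⧸ N)) := by
      intro q
      obtain ⟨a, ha⟩ := QuotientAddGroup.mk_surjective q.toAdd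
      refine ⟨v, Multiplicative.toAdd.injective ?_⟩
      rw [toAdd_pow, ← ha, toAdd_one, ← QuotientAddGroup.mk_nsmul, QuotientAddGroup.eq_zero_iff]
      exact Submodule.mem_sup_right ⟨a, by
        rw [LinearMap.smul_apply, Module.End.one_apply, natCast_zsmul]⟩
    obtain ⟨j, hj⟩ := IsPGroup.iff_card.1 h1
    exact ⟨j, hj⟩
  have htriv (b : B) : (AddMonoidHom.toMultiplicative (QuotientAddGroup.mk' N)).ker ≤
      (χ b).toHomUnits.ker := by
    intro a ha
    have ha' : a.toAdd ∈ N := (QuotientAddGroup.eq_zero_iff _).1 ha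
    obtain ⟨_, ⟨c, rfl⟩, _, ⟨d, rfl⟩, hcd⟩ := Submodule.mem_sup.1 ha'
    rw [MonoidHom.mem_ker, Units.ext_iff]
    have : a = .ofAdd (φ c) * .ofAdd d ^ ℓ ^ v := by
      rw [← ofAdd_nsmul, ← ofAdd_add, ← ofAdd_toAdd a, ← hcd,
        LinearMap.smul_apply, Module.End.one_apply, natCast_zsmul]
    simp [this, hφ, hv]
  let ψ (b : B) : Multiplicative ((Fin n → ℤ) ⧸ N) →* K :=
    (Units.coeHom K).comp (MonoidHom.liftOfSurjective
      (AddMonoidHom.toMultiplicative (QuotientAddGroup.mk' N))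
      (QuotientAddGroup.mk'_surjective N) ⟨(χ b).toHomUnits, htriv b⟩)
  have hψ (b : B) (a) : ψ b (AddMonoidHom.toMultiplicative (QuotientAddGroup.mk' N) a) = χ b a := by
    simp only [ψ, MonoidHom.comp_apply]
    erw [MonoidHom.liftOfRightInverse_comp_apply]
    rfl
  have hinj : Function.Injective ψ := by
    intro b c hbc
    refine hχ (MonoidHom.ext fun a => ?_)
    rw [← hψ, ← hψ, hbc]
  obtain ⟨hf, hcard⟩ := card_monoidHom_le (Multiplicative ((Fin n → ℤ) ⧸ N)) K
  have hle2 : ℓ ^ v ≤ N.index := hB ▸ (Nat.card_le_card_of_injective ψ hinj).trans hcard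
  obtain ⟨j, hj⟩ := hpg
  rw [hj] at hle2 hdvd
  have hvj : v ≤ j := (Nat.pow_le_pow_iff_right hℓ.one_lt).1 hle2
  have := (pow_dvd_pow ℓ hvj).trans hdvd
  exact_mod_cast Int.natCast_dvd.2 this

/-! ### The bound -/

theorem theorem4 {k : Type*} [Field k] (ℓ : ℕ) [Fact ℓ.Prime] (hℓ : (ℓ : k) ≠ 0)
    {H : Type*} [CommRing H] [HopfAlgebra k H] (n : ℕ) (hT : IsTorusOfDim k H n)
    (A : Subgroup (RationalPoints k H)) [Finite A] :
    (padicValNat ℓ (Nat.card A) : ℕ∞) ≤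
      cyclotomicM k ℓ * ((n / Nat.totient (cyclotomicT k ℓ) : ℕ) : ℕ∞) := by
  have hp : ℓ.Prime := Fact.out
  have : NeZero (ℓ : AlgebraicClosure k) := ⟨by
    rw [← map_natCast (algebraMap k (AlgebraicClosure k))]
    exact (map_ne_zero _).2 hℓ⟩
  have (i : ℕ) : HasEnoughRootsOfUnity (AlgebraicClosure k) (ℓ ^ i) := by
    have : NeZero ((ℓ ^ i : ℕ) : AlgebraicClosure k) :=
      ⟨by rw [Nat.cast_pow]; exact pow_ne_zero _ (NeZero.ne _)⟩
    infer_instance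
  obtain ⟨e⟩ := hT
  set v := padicValNat ℓ (Nat.card A) with hv
  obtain ⟨B, hB⟩ : ∃ B : Subgroup A, Nat.card B = ℓ ^ v :=
    Sylow.exists_subgroup_card_pow_prime ℓ pow_padicValNat_dvd
  obtain ⟨S, hS1, hvS, hS⟩ : ∃ S : ℕ, 1 ≤ S ∧ v ≤ S ∧
      ∀ m : ℕ, unitInvM (cyclotomicImage k ℓ) = m → m + 1 ≤ S :=
    -- For infinite `m`, `toNat` returns 0, which is harmless: the last condition is then vacuous.
    ⟨v + (unitInvM (cyclotomicImage k ℓ)).toNat + 1, by omega, by omega, fun m hm => by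
      rw [hm, ENat.toNat_natCast]; omega⟩
  obtain ⟨x, ⟨g, rfl⟩, hx⟩ := exists_unit_cyclotomic_bound (cyclotomicImage k ℓ) hS1 hS
  set x : ℤ_[ℓ]ˣ := ((cyclotomicCharacter (AlgebraicClosure k) ℓ).comp
    (MulSemiringAction.toRingAut Gal(AlgebraicClosure k/k) (AlgebraicClosure k))) g with hxdef
  set z : ℕ := (PadicInt.toZModPow S (x : ℤ_[ℓ])).val with hz
  -- Adding `ℓ ^ S` keeps the residue class and forces `y ≥ 2`.
  set y : ℕ := z + ℓ ^ S with hy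
  have : NeZero (ℓ ^ S) := ⟨pow_ne_zero _ hp.ne_zero⟩
  have hzx : PadicInt.toZModPow S (x : ℤ_[ℓ]) = z := by rw [hz, ZMod.natCast_zmod_val]
  obtain ⟨M, hM, hcyc⟩ := hx y
    (by have := hp.two_le.trans (Nat.le_self_pow (by omega : S ≠ 0) ℓ)
        have : 2 ≤ y := by omega
        exact_mod_cast this) (by
      rw [← Ideal.mem_span_singleton, ← PadicInt.ker_toZModPow, RingHom.mem_ker, map_sub,
        hzx, hy]
      push_cast
      rw [map_add, map_natCast, map_pow, map_natCast, add_sub_cancel_left, ← Nat.cast_pow,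
        ZMod.natCast_self])
  have hgy (ζ : AlgebraicClosure k) (hζ : ζ ^ ℓ ^ v = 1) : g ζ = ζ ^ y := by
    have hζ' : ζ ^ ℓ ^ S = 1 := by
      rw [← Nat.add_sub_of_le hvS, pow_add, pow_mul, hζ, one_pow]
    rw [hy, pow_add, hζ', mul_one]
    exact cyclotomicCharacter.spec ℓ
      (MulSemiringAction.toRingAut Gal(AlgebraicClosure k/k) (AlgebraicClosure k) g) ζ hζ'
  obtain ⟨ρ₀, hρ₀⟩ := exists_character_act e (g : AlgebraicClosure k →ₐ[k] AlgebraicClosure k)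
  set ρ : Module.End ℤ (Fin n → ℤ) := ρ₀.toIntLinearMap with hρdef
  obtain ⟨N, hN, hρN⟩ := exists_pow_eq_one_of_character_act (ρ := ρ) e hρ₀
  obtain ⟨r, hr, hrM⟩ := exists_emultiplicity_eval_le hp hN hcyc ρ.charpoly
    (charpoly_dvd_of_pow_eq_one hρN)
  rw [LinearMap.charpoly_natDegree, Module.finrank_fin_fun] at hr
  rw [LinearMap.eval_charpoly] at hrM
  have hpow (b : B) (a) : RationalPoints.pairing e (b : A).1 a ^ ℓ ^ v = 1 := by
    rw [← MonoidHom.pow_apply, ← map_pow]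
    have : b ^ ℓ ^ v = 1 := by rw [← hB]; exact pow_card_eq_one'
    have : ((b : A).1) ^ ℓ ^ v = 1 := congrArg (fun c : B => (c : A).1) this
    rw [this, map_one, MonoidHom.one_apply]
  have hdvd := pow_dvd_det_of_characters (φ := algebraMap ℤ _ (y : ℤ) - ρ) hp hB
    (fun b : B => RationalPoints.pairing e (b : A).1)
    (fun b c h => Subtype.ext (Subtype.ext (RationalPoints.pairing_injective e h))) hpow
    (fun b a => by
      have h1 := pairing_character_act e hρ₀ (b : A).1 a
      have h2 : RationalPoints.pairing e (b : A).1 (.ofAdd ((algebraMap ℤ _ (y : ℤ) - ρ) a)) *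
          RationalPoints.pairing e (b : A).1 (.ofAdd (ρ₀ a)) =
            RationalPoints.pairing e (b : A).1 (.ofAdd a) ^ y := by
        rw [← map_mul, ← ofAdd_add, ← map_pow, ← ofAdd_nsmul]
        congr 2
        simp [hρdef]
      have h3 : g (RationalPoints.pairing e (b : A).1 (.ofAdd a)) = _ := hgy _ (hpow b (.ofAdd a))
      -- The value at `(y - ρ) a` times the value at `ρ a` is the `y`-th power of the value at `a`,
      -- which is again the value at `ρ a`; cancel it.
      have h4 : RationalPoints.pairing e (b : A).1 (.ofAdd (ρ₀ a)) ≠ 0 := by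
        intro h0
        have := hpow b (.ofAdd (ρ₀ a))
        rw [h0, zero_pow (pow_ne_zero _ hp.ne_zero)] at this
        exact zero_ne_one this
      refine mul_right_cancel₀ h4 ?_
      rw [h2, one_mul, h1, ← h3]
      rfl)
  have hvM : v ≤ M * r := by
    have := (pow_dvd_iff_le_emultiplicity.1 hdvd).trans hrM
    exact_mod_cast this
  have ht0 : 0 < (unitInvT (cyclotomicImage k ℓ)).totient := Nat.totient_pos.2 (unitInvT_pos _)
  have hrn : r ≤ n / (unitInvT (cyclotomicImage k ℓ)).totient := (Nat.le_div_iff_mul_le ht0).2 hr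
  unfold cyclotomicM cyclotomicT
  generalize unitInvM (cyclotomicImage k ℓ) = m at *
  induction m with
  | top =>
    -- Here `M` is finite but uncontrolled; if the quotient is 0, then `r = 0` and `v ≤ M * r` still
    -- gives `v = 0`.
    obtain h0 | h0 := Nat.eq_zero_or_pos (n / (unitInvT (cyclotomicImage k ℓ)).totient)
    · have : v = 0 := by
        rw [h0] at hrn
        simpa [Nat.le_zero.1 hrn] using hvM
      simp [this]
    · rw [ENat.top_mul (by exact_mod_cast h0.ne')]
      exact le_top
  | coe m =>
    rw [hM m rfl] at hvM
    exact_mod_cast hvM.trans (Nat.mul_le_mul_left m hrn)
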